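/- **Theorem 4.3.** Let $\mathbb F=\mathbb F_q$ be a finite field, let $n=q-1$, let $\alpha\in\mathbb F$ be an element of multiplicative order $n$, and let $k$ be an integer with $1\le k\le n/2$. Put $A=\mathbb F[x]/\langle x^n-1\rangle$ and let $\mathfrak v:A\to\mathbb F^n$ be the inverse of the isomorphism $(v_0,\dots,v_{n-1})\mapsto\sum_{i=0}^{n-1}v_ix^i$. Let $\sigma$ be the $\mathbb F$-algebra automorphism of $A$ with $\sigma(x)=\alpha^kx$. For $0\le i\le n-1$ let $\varepsilon_i\in A$ be the primitive idempotent determined by $\varepsilon_i \bmod (x-\alpha^j)=\delta_{ij}$ for $0\le j\le n-1$, and put $c=\varepsilon_{n-k}+\dots+\varepsilon_{n-1}$. Let $1\le m\le\lfloor n/k\rfloor-1$ and let $$G=\sum_{\nu=0}^m z^\nu G_\nu\in\mathbb F[z]^{k\times n},$$ where $G_\nu\in\mathbb F^{k\times n}$ is the matrix with rows $\mathfrak v(\sigma^\nu(c)),\mathfrak v(\sigma^\nu(xc)),\dots,\mathfrak v(\sigma^\nu(x^{k-1}c))$. Let $\mathcal C=\{uG\mid u\in\mathbb F[z]^k\}\subseteq\mathbb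 F[z]^n$ be the resulting Reed–Solomon convolutional code. The weight of $v=\sum_j z^jv_j\in\mathbb F[z]^n$ (with $v_j\in\mathbb F^n$) is $\mathrm{wt}(v)=\sum_j\mathrm{wt}(v_j)$, where $\mathrm{wt}(v_j)$ is the Hamming weight; the free distance is $\mathrm{dist}(\mathcal C)=\min\{\mathrm{wt}(v)\mid v\in\mathcal C,\ v\ne0\}$. For $j\ge m+1$ the $j$th extended row distance $\hat d^r_j$ of $\mathcal C$ is the minimum of $\mathrm{wt}(uG)$ over all $u=\sum_i z^iu_i\in\mathbb F[z]^k$ (with $u_i\in\mathbb F^k$) such that $u_0\ne0$, $\deg u=j-m-1$, and no $m$ consecutive coefficients among $u_0,\dots,u_{\deg u}$ are all zero. Then 1. $\mathrm{dist}(\mathcal C)=(m+1)(n-k+1)$; 2. $\hat d^r_j\ge(m+1)(n-k+1)+(j-1-m)\bigl(n-k(m+1)+1\bigr)$ for all $j\ge m+1$. -/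

import Mathlib

open Polynomial

noncomputable section

namespace RSConv

variable {F : Type*} [Field F]

/-! ### Weight, degree and distance for polynomial vectors -/

/-- The coefficient vector `v_j ∈ F^ι` of `z^j` in `v = ∑ z^j v_j ∈ F[z]^ι`. -/
def coeffVec {ι : Type*} (v : ι → F[X]) (j : ℕ) : ι → F := fun l => (v l).coeff j

/-- The degree of a polynomial vector: the maximum of the degrees of its components
(`⊥` for the zero vector). -/
def vecDegree {ι : Type*} [Fintype ι] (v : ι → F[X]) : WithBot ℕ :=
  Finset.univ.sup fun l => (v l).degree

open Classical in
/-- The weight of `v = ∑_{j ≤ N} z^j v_j`: the sum of the Hamming weights of the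
coefficient vectors `v_j`. -/
def polyWeight {ι : Type*} [Fintype ι] (v : ι → F[X]) : ℕ :=
  ∑ j ∈ Finset.range (Finset.univ.sup (fun l => (v l).natDegree) + 1), hammingNorm (coeffVec v j)

/-- The submodule `im G = {uG | u ∈ F[z]^k}` of `F[z]^n`. -/
def code {k n : ℕ} (G : Matrix (Fin k) (Fin n) F[X]) : Submodule F[X] (Fin n → F[X]) :=
  LinearMap.range G.vecMulLinear

/-- The free distance `min {wt v | v ∈ C, v ≠ 0}`. -/
def freeDist {n : ℕ} (C : Submodule F[X] (Fin n → F[X])) : ℕ :=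
  sInf {w | ∃ v ∈ C, v ≠ 0 ∧ polyWeight v = w}

/-- The messages `u` with `u_0 ≠ 0`, `deg u = j - m - 1`, and such that no `m` consecutive
coefficients among `u_0, …, u_{deg u}` all vanish. -/
def IsAtomicMessage {k : ℕ} (m j : ℕ) (u : Fin k → F[X]) : Prop :=
  coeffVec u 0 ≠ 0 ∧ vecDegree u + m + 1 = j ∧
    ∀ i : ℕ, (i : WithBot ℕ) + m ≤ vecDegree u + 1 → ∃ l < m, coeffVec u (i + l) ≠ 0

/-- The `j`th extended row distance (`j ≥ m + 1`) of `im G`, where `G` is a minimal generator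
matrix all of whose row degrees are equal to `m`. -/
def extRowDist {k n : ℕ} (G : Matrix (Fin k) (Fin n) F[X]) (m j : ℕ) : ℕ :=
  sInf {w | ∃ u : Fin k → F[X], IsAtomicMessage m j u ∧ polyWeight (Matrix.vecMul u G) = w}

/-! ### The algebra `A = F[x]/(x^n - 1)` -/

variable (F) in
/-- `A = F[x]/(x^n - 1)`. -/
abbrev CycAlg (n : ℕ) : Type _ := AdjoinRoot (X ^ n - 1 : F[X])

variable (F) in
/-- The residue class of `x` in `A`. -/
def gen (n : ℕ) : CycAlg F n := AdjoinRoot.root (X ^ n - 1 : F[X])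

theorem monic_X_pow_sub_one (n : ℕ) [NeZero n] : (X ^ n - 1 : F[X]).Monic := by
  simpa using monic_X_pow_sub_C (1 : F) (NeZero.ne n)

/-- The coordinate map `A → F^n`, inverse to `(v_0, …, v_{n-1}) ↦ ∑ v_i x^i`: the coefficients of
the remainder modulo `x^n - 1`. -/
def coords {n : ℕ} [NeZero n] (a : CycAlg F n) : Fin n → F :=
  fun i => (AdjoinRoot.modByMonicHom (monic_X_pow_sub_one n) a).coeff i

theorem gen_pow (n : ℕ) : gen F n ^ n = 1 := by
  have h : AdjoinRoot.mk (X ^ n - 1 : F[X]) (X ^ n - 1) = 0 := AdjoinRoot.mk_self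
  rw [map_sub, map_pow, AdjoinRoot.mk_X, map_one, sub_eq_zero] at h
  exact h

/-- The endomorphism of the `F`-algebra `A` with `x ↦ a x`, where `a^n = 1`. -/
def scaleHom {n : ℕ} (a : F) (ha : a ^ n = 1) : CycAlg F n →ₐ[F] CycAlg F n :=
  AdjoinRoot.liftAlgHom (X ^ n - 1 : F[X]) (Algebra.ofId F (CycAlg F n)) (a • gen F n) (by
    simp [_root_.smul_pow, ha, gen_pow])

theorem scaleHom_gen {n : ℕ} (a : F) (ha : a ^ n = 1) :
    scaleHom a ha (gen F n) = a • gen F n := by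
  simp only [scaleHom]
  exact AdjoinRoot.liftAlgHom_root _ _ _ _

theorem scaleHom_comp {n : ℕ} (a b : F) (ha : a ^ n = 1) (hb : b ^ n = 1) (hab : a * b = 1) :
    (scaleHom a ha).comp (scaleHom b hb) = AlgHom.id F (CycAlg F n) := by
  apply AdjoinRoot.algHom_ext
  change scaleHom a ha (scaleHom b hb (gen F n)) = gen F n
  rw [scaleHom_gen, map_smul, scaleHom_gen, smul_smul, mul_comm, hab, one_smul]

/-- The automorphism of the `F`-algebra `A` with `x ↦ a x`, where `a^n = 1` and `n > 0`. -/
def scaleAut {n : ℕ} [NeZero n] (a : F) (ha : a ^ n = 1) : CycAlg F n ≃ₐ[F] CycAlg F n :=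
  have h0 : a ≠ 0 := by
    rintro rfl
    simp [NeZero.ne n] at ha
  AlgEquiv.ofAlgHom (scaleHom a ha) (scaleHom a⁻¹ (by rw [inv_pow, ha, inv_one]))
    (scaleHom_comp _ _ _ _ (mul_inv_cancel₀ h0)) (scaleHom_comp _ _ _ _ (inv_mul_cancel₀ h0))

theorem scaleAut_gen {n : ℕ} [NeZero n] (a : F) (ha : a ^ n = 1) :
    scaleAut a ha (gen F n) = a • gen F n := scaleHom_gen a ha

/-! ### The generator matrix of a doubly-cyclic code -/

/-- The matrix `G_ν` with rows `𝔳(σ^ν(x^i c))`, `0 ≤ i < k`. -/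
def coeffMatrix {n : ℕ} [NeZero n] (σ : CycAlg F n ≃ₐ[F] CycAlg F n) (c : CycAlg F n) (k ν : ℕ) :
    Matrix (Fin k) (Fin n) F :=
  Matrix.of fun i => coords ((σ ^ ν) (gen F n ^ (i : ℕ) * c))

/-- The matrix `G = ∑_{ν = 0}^m z^ν G_ν`. -/
def genMatrix {n : ℕ} [NeZero n] (σ : CycAlg F n ≃ₐ[F] CycAlg F n) (c : CycAlg F n) (k m : ℕ) :
    Matrix (Fin k) (Fin n) F[X] :=
  ∑ ν ∈ Finset.range (m + 1), (X ^ ν : F[X]) • (coeffMatrix σ c k ν).map C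

/-! ### The Reed-Solomon data -/

/-- For `α` of order `n` and `i < n`: the primitive idempotent `ε_i` of `A`, i.e. the element with
`ε_i mod (x - α^j) = δ_ij` for all `j < n`, given as a scalar multiple of
`∏_{j ≠ i} (x - α^j)`. -/
def idem (n : ℕ) (α : F) (i : ℕ) : CycAlg F n :=
  AdjoinRoot.mk _ (Lagrange.basis (Finset.range n) (fun j => α ^ j) i)

/-- The defining property of the representing polynomial of `ε_i`. -/
theorem idem_mod {n : ℕ} {α : F} (hα : orderOf α = n) {i j : ℕ} (hi : i < n) (hj : j < n) :
    Lagrange.basis (Finset.range n) (fun j => α ^ j) i %ₘ (X - C (α ^ j)) =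
      if i = j then 1 else 0 := by
  have hinj : Set.InjOn (fun j => α ^ j) (Finset.range n : Set ℕ) := by
    intro a ha b hb h
    simp only [Finset.coe_range, Set.mem_Iio] at ha hb
    subst hα
    exact pow_injOn_Iio_orderOf ha hb h
  rw [modByMonic_X_sub_C_eq_C_eval]
  split_ifs with h
  · subst h
    have := Lagrange.eval_basis_self hinj (Finset.mem_range.2 hi)
    rw [this, C_1]
  · have := Lagrange.eval_basis_of_ne (v := fun j => α ^ j) h (Finset.mem_range.2 hj)
    rw [this, C_0]

/-- The idempotent `c = ε_{n-k} + ⋯ + ε_{n-1}`. -/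
def rsIdem (n : ℕ) (α : F) (k : ℕ) : CycAlg F n := ∑ i ∈ Finset.Ico (n - k) n, idem n α i

theorem pow_pow_of_order {n : ℕ} {α : F} (hα : orderOf α = n) (k : ℕ) : (α ^ k) ^ n = 1 := by
  rw [← hα, pow_right_comm, pow_orderOf_eq_one, one_pow]

/-- The automorphism `σ` of `A` with `σ(x) = α^k x`. -/
def rsAut {n : ℕ} [NeZero n] {α : F} (hα : orderOf α = n) (k : ℕ) : CycAlg F n ≃ₐ[F] CycAlg F n :=
  scaleAut (α ^ k) (pow_pow_of_order hα k)

/-- The generator matrix of the Reed-Solomon convolutional code. -/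
def rsMatrix {n : ℕ} [NeZero n] {α : F} (hα : orderOf α = n) (k m : ℕ) :
    Matrix (Fin k) (Fin n) F[X] :=
  genMatrix (rsAut hα k) (rsIdem n α k) k m

end RSConv

end

open Polynomial

namespace RSConv

section Lemmas

variable {F : Type*} [Field F]

/-! ### Weights of polynomial vectors -/

/-! Read elements of `A` in the frequency domain, by their values at the powers `α^j`. The
idempotent `c` is the indicator of the last `k` frequencies, and `σ` shifts frequencies by `k`, so
the words of `G_0, …, G_m` occupy pairwise disjoint blocks of `k` frequencies; this needs `k (m + 1)
≤ n`. A nonzero combination of `r` consecutive blocks vanishes at `n - k r` consecutive powers of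
`α`, so the BCH bound gives it weight at least `n + 1 - k r` (`le_hammingNorm_sum_blocks`).

The coefficient of `z^t` in `uG` is such a combination, using the blocks `ν` for which `u_(t-ν)` can
be nonzero. Suppose `u` vanishes before `a` and on `(b, b + m]`, and each window ending in `[a, b +
m]` meets a nonzero coefficient. Summing over these `t`, with `L = b - a + 1`, gives weight at least
`(L + m) (n + 1) - k L (m + 1)` (`le_polyWeight_of_windows`). For atomic messages this is the row
distance bound. For arbitrary nonzero `u` it is applied up to the first gap of `m` zeros, and the
terms depending on `L - 1` are nonnegative.

Equality in the free distance comes from a constant message `w` for which `w G_0` vanishes in `k -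
1` coordinates: `σ` only rescales coordinates, so all `m + 1` coefficients share these zeros. -/

open Classical in
theorem sum_hammingNorm_le_polyWeight {ι : Type*} [Fintype ι] (v : ι → F[X]) (S : Finset ℕ) :
    ∑ t ∈ S, hammingNorm (coeffVec v t) ≤ polyWeight v := by
  unfold polyWeight
  refine Finset.sum_le_sum_of_ne_zero fun t _ ht => ?_
  by_contra hlt
  apply ht
  rw [hammingNorm_eq_zero]
  funext l
  refine coeff_eq_zero_of_natDegree_lt ?_
  have : (v l).natDegree ≤ Finset.univ.sup fun l => (v l).natDegree :=
    Finset.le_sup (f := fun l => (v l).natDegree) (Finset.mem_univ l)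
  rw [Finset.mem_range] at hlt
  omega

open Classical in
theorem polyWeight_le_sum_hammingNorm {ι : Type*} [Fintype ι] (v : ι → F[X]) (S : Finset ℕ)
    (h : ∀ t ∉ S, coeffVec v t = 0) :
    polyWeight v ≤ ∑ t ∈ S, hammingNorm (coeffVec v t) := by
  unfold polyWeight
  refine Finset.sum_le_sum_of_ne_zero fun t _ ht => ?_
  by_contra hS
  exact ht (hammingNorm_eq_zero.2 (h t hS))

/-! ### The BCH bound -/

open Classical in
/-- A nonzero word whose polynomial vanishes at `d` consecutive powers of an element of order `n`
has weight greater than `d`. -/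
theorem lt_hammingNorm_of_consecutive_zeros {n : ℕ} {α : F} (hα : orderOf α = n) {v : Fin n → F}
    (hv : v ≠ 0) (b d : ℕ) (h : ∀ j < d, ∑ i, v i * (α ^ (b + j)) ^ (i : ℕ) = 0) :
    d < hammingNorm v := by
  by_contra! hd
  obtain ⟨i₀, hi₀⟩ := Function.ne_iff.1 hv
  rw [Pi.zero_apply] at hi₀
  have hα0 : α ≠ 0 := by
    rintro rfl
    rw [orderOf_zero] at hα
    subst hα
    exact i₀.elim0
  set S : Finset (Fin n) := Finset.univ.filter fun i => v i ≠ 0 with hS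
  have hi₀S : i₀ ∈ S := by simp [hS, hi₀]
  have hcard : S.card ≤ d := hd
  set g : F[X] := ∏ i ∈ S.erase i₀, (X - C (α ^ (i : ℕ))) with hg
  have hdeg : g.natDegree < d := by
    rw [hg, natDegree_prod_of_monic _ _ fun i _ => monic_X_sub_C _]
    simp only [natDegree_X_sub_C, Finset.sum_const, smul_eq_mul, mul_one]
    exact (Finset.card_erase_lt_of_mem hi₀S).trans_le hcard
  have key : ∑ i, v i * (α ^ b) ^ (i : ℕ) * g.eval (α ^ (i : ℕ)) = 0 := by
    calc ∑ i, v i * (α ^ b) ^ (i : ℕ) * g.eval (α ^ (i : ℕ))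
        = ∑ i, ∑ j ∈ Finset.range d, g.coeff j * (v i * (α ^ (b + j)) ^ (i : ℕ)) := by
          refine Finset.sum_congr rfl fun i _ => ?_
          rw [eval_eq_sum_range' hdeg, Finset.mul_sum]
          refine Finset.sum_congr rfl fun j _ => ?_
          ring
      _ = ∑ j ∈ Finset.range d, g.coeff j * ∑ i, v i * (α ^ (b + j)) ^ (i : ℕ) := by
          rw [Finset.sum_comm]
          simp only [Finset.mul_sum]
      _ = 0 := Finset.sum_eq_zero fun j hj => by rw [h j (Finset.mem_range.1 hj), mul_zero]
  rw [Finset.sum_eq_single i₀] at key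
  · have hne : g.eval (α ^ (i₀ : ℕ)) ≠ 0 := by
      rw [hg, eval_prod, Finset.prod_ne_zero_iff]
      intro i hi
      rw [eval_sub, eval_X, eval_C, sub_ne_zero]
      intro heq
      have : (i₀ : ℕ) = i := pow_injOn_Iio_orderOf (hα ▸ i₀.2) (hα ▸ i.2) heq
      exact (Finset.mem_erase.1 hi).1 (Fin.ext this.symm)
    exact mul_ne_zero (mul_ne_zero hi₀ (pow_ne_zero _ (pow_ne_zero _ hα0))) hne key
  · intro i _ hi
    by_cases hvi : v i = 0
    · simp [hvi]
    · have : g.eval (α ^ (i : ℕ)) = 0 := by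
        rw [hg, eval_prod]
        exact Finset.prod_eq_zero (Finset.mem_erase.2 ⟨hi, by simp [hS, hvi]⟩) (by simp)
      rw [this, mul_zero]
  · simp

/-! ### Coordinates and evaluations of elements of `A` -/

theorem coords_sum {n : ℕ} [NeZero n] (d : Fin n → F) :
    coords (∑ i, d i • gen F n ^ (i : ℕ)) = d := by
  have hmk : ∑ i, d i • gen F n ^ (i : ℕ) =
      AdjoinRoot.mk (X ^ n - 1 : F[X]) (∑ i : Fin n, C (d i) * X ^ (i : ℕ)) := by
    simp [gen, Algebra.smul_def]
  have hdeg : (∑ i : Fin n, C (d i) * X ^ (i : ℕ)).degree < (X ^ n - 1 : F[X]).degree := by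
    rw [← C_1, degree_X_pow_sub_C (NeZero.pos n)]
    exact degree_sum_fin_lt d
  funext j
  rw [coords, hmk, AdjoinRoot.modByMonicHom_mk,
    (modByMonic_eq_self_iff (monic_X_pow_sub_one n)).2 hdeg]
  simp only [finsetSum_coeff, coeff_C_mul_X_pow]
  simp [Fin.val_inj]

theorem sum_coords {n : ℕ} [NeZero n] (a : CycAlg F n) :
    ∑ i, coords a i • gen F n ^ (i : ℕ) = a := by
  have hM := monic_X_pow_sub_one (F := F) n
  have hdeg : (AdjoinRoot.modByMonicHom hM a).natDegree < n := by
    obtain ⟨p, rfl⟩ := AdjoinRoot.mk_surjective a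
    rw [AdjoinRoot.modByMonicHom_mk]
    have hne : (X ^ n - 1 : F[X]) ≠ 1 := by
      intro h
      have := congrArg natDegree h
      rw [← C_1, natDegree_X_pow_sub_C, natDegree_C] at this
      exact NeZero.ne n this
    have := natDegree_modByMonic_lt p hM hne
    rwa [← C_1, natDegree_X_pow_sub_C] at this
  conv_rhs => rw [← AdjoinRoot.mk_leftInverse hM a, as_sum_range' _ n hdeg]
  rw [map_sum, ← Fin.sum_univ_eq_sum_range (fun i => AdjoinRoot.mk (X ^ n - 1 : F[X])
    (monomial i ((AdjoinRoot.modByMonicHom hM a).coeff i)))]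
  refine Finset.sum_congr rfl fun i _ => ?_
  rw [← C_mul_X_pow_eq_monomial, map_mul, map_pow, AdjoinRoot.mk_C, AdjoinRoot.mk_X,
    Algebra.smul_def]
  rfl

/-- Evaluation of elements of `A` at an `n`th root of unity. -/
noncomputable def evalAt {n : ℕ} (y : F) (hy : y ^ n = 1) : CycAlg F n →ₐ[F] F :=
  AdjoinRoot.liftAlgHom (X ^ n - 1 : F[X]) (Algebra.ofId F F) y (by simp [hy])

theorem evalAt_gen {n : ℕ} (y : F) (hy : y ^ n = 1) : evalAt y hy (gen F n) = y := by
  exact AdjoinRoot.liftAlgHom_root _ _ _ _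

theorem evalAt_mk {n : ℕ} (y : F) (hy : y ^ n = 1) (p : F[X]) :
    evalAt y hy (AdjoinRoot.mk _ p) = p.eval y := by
  rw [evalAt, AdjoinRoot.liftAlgHom_mk]
  rfl

theorem sum_coords_mul_pow {n : ℕ} [NeZero n] (a : CycAlg F n) (y : F) (hy : y ^ n = 1) :
    ∑ i, coords a i * y ^ (i : ℕ) = evalAt y hy a := by
  conv_rhs => rw [← sum_coords a]
  simp [evalAt_gen]

theorem coords_add {n : ℕ} [NeZero n] (a b : CycAlg F n) :
    coords (a + b) = coords a + coords b := by
  funext i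
  simp [coords]

theorem coords_smul {n : ℕ} [NeZero n] (r : F) (a : CycAlg F n) :
    coords (r • a) = r • coords a := by
  funext i
  simp [coords]

/-- `coords` as a linear map. -/
noncomputable def coordsLin (n : ℕ) [NeZero n] : CycAlg F n →ₗ[F] (Fin n → F) where
  toFun := coords
  map_add' := coords_add
  map_smul' := coords_smul

theorem scaleAut_pow_gen {n : ℕ} [NeZero n] (a : F) (ha : a ^ n = 1) (ν : ℕ) :
    (scaleAut a ha ^ ν) (gen F n) = a ^ ν • gen F n := by
  induction ν with
  | zero => simp
  | succ ν ih => rw [pow_succ', AlgEquiv.mul_apply, ih, map_smul, scaleAut_gen, smul_smul, pow_succ]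

/-- The automorphism is diagonal in the monomial basis; in particular it preserves the support of a
word. -/
theorem coords_scaleAut_pow {n : ℕ} [NeZero n] (a : F) (ha : a ^ n = 1) (ν : ℕ) (b : CycAlg F n)
    (i : Fin n) :
    coords ((scaleAut a ha ^ ν) b) i = coords b i * (a ^ ν) ^ (i : ℕ) := by
  conv_lhs => rw [← sum_coords b]
  simp only [map_sum, map_smul, map_pow, scaleAut_pow_gen, _root_.smul_pow, smul_smul]
  rw [coords_sum fun i => coords b i * (a ^ ν) ^ (i : ℕ)]

theorem evalAt_scaleAut_pow {n : ℕ} [NeZero n] (a : F) (ha : a ^ n = 1) (ν : ℕ) (b : CycAlg F n)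
    (y : F) (hy : y ^ n = 1) (hay : (a ^ ν * y) ^ n = 1) :
    evalAt y hy ((scaleAut a ha ^ ν) b) = evalAt (a ^ ν * y) hay b := by
  rw [← sum_coords_mul_pow, ← sum_coords_mul_pow]
  refine Finset.sum_congr rfl fun i _ => ?_
  rw [coords_scaleAut_pow, mul_pow, mul_assoc]

theorem evalAt_rsIdem {n : ℕ} [NeZero n] {α : F} (hα : orderOf α = n) {k : ℕ} (j : ℕ) :
    evalAt (α ^ j) (pow_pow_of_order hα j) (rsIdem n α k) = if n - k ≤ j % n then 1 else 0 := by
  have hjn : j % n < n := Nat.mod_lt _ (NeZero.pos n)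
  have hj : α ^ j = α ^ (j % n) := by rw [← hα, pow_mod_orderOf]
  have hε : ∀ i ∈ Finset.Ico (n - k) n,
      evalAt (α ^ j) (pow_pow_of_order hα j) (idem n α i) = if i = j % n then 1 else 0 := by
    intro i hi
    have h := idem_mod hα (Finset.mem_Ico.1 hi).2 hjn
    rw [modByMonic_X_sub_C_eq_C_eval, ← hj] at h
    rw [idem, evalAt_mk]
    refine C_injective ?_
    rw [h]
    split_ifs <;> simp
  rw [rsIdem, map_sum, Finset.sum_congr rfl hε, Finset.sum_ite_eq']
  simp [hjn]

end Lemmas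

section Code

variable {F : Type*} [Field F]

/-! ### Messages and code words -/

/-- The element `∑_{i < k} w_i x^i` of `A`. -/
noncomputable def msgElem (n : ℕ) {k : ℕ} (w : Fin k → F) : CycAlg F n :=
  ∑ i, w i • gen F n ^ (i : ℕ)

theorem vecMul_coeffMatrix {n : ℕ} [NeZero n] (σ : CycAlg F n ≃ₐ[F] CycAlg F n) (c : CycAlg F n)
    {k : ℕ} (ν : ℕ) (w : Fin k → F) :
    Matrix.vecMul w (coeffMatrix σ c k ν) = coords ((σ ^ ν) (msgElem n w * c)) := by
  change _ = coordsLin n _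
  rw [Matrix.vecMul_eq_sum, msgElem, Finset.sum_mul, map_sum, map_sum]
  refine Finset.sum_congr rfl fun i _ => ?_
  rw [smul_mul_assoc, map_smul, map_smul]
  rfl

theorem coeffVec_vecMul_genMatrix {n : ℕ} [NeZero n] (σ : CycAlg F n ≃ₐ[F] CycAlg F n)
    (c : CycAlg F n) {k : ℕ} (m : ℕ) (u : Fin k → F[X]) (t : ℕ) :
    coeffVec (Matrix.vecMul u (genMatrix σ c k m)) t =
      ∑ ν ∈ Finset.range (m + 1),
        if ν ≤ t then Matrix.vecMul (coeffVec u (t - ν)) (coeffMatrix σ c k ν) else 0 := by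
  funext l
  have h : Matrix.vecMul u (genMatrix σ c k m) l =
      ∑ ν ∈ Finset.range (m + 1), ∑ i, u i * C (coeffMatrix σ c k ν i l) * X ^ ν := by
    rw [genMatrix, Matrix.vecMul, dotProduct, Finset.sum_comm]
    refine Finset.sum_congr rfl fun i _ => ?_
    rw [Matrix.sum_apply, Finset.mul_sum]
    refine Finset.sum_congr rfl fun ν _ => ?_
    rw [Matrix.smul_apply, Matrix.map_apply, smul_eq_mul]
    ring
  rw [coeffVec, h, finsetSum_coeff, Finset.sum_apply]
  refine Finset.sum_congr rfl fun ν _ => ?_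
  rw [finsetSum_coeff]
  simp only [coeff_mul_X_pow', coeff_mul_C]
  split_ifs with hν
  · rfl
  · simp

theorem evalAt_msgElem {n k : ℕ} (y : F) (hy : y ^ n = 1) (w : Fin k → F) :
    evalAt y hy (msgElem n w) = ∑ i, w i * y ^ (i : ℕ) := by
  simp [msgElem, evalAt_gen]

/-- A polynomial of degree below `k` with `k` distinct roots is zero; `b + k ≤ n` keeps the powers
of `α` distinct. -/
theorem eq_zero_of_evalAt_msgElem {n k : ℕ} {α : F} (hα : orderOf α = n)
    {w : Fin k → F} (b : ℕ) (hb : b + k ≤ n)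
    (h : ∀ j < k, evalAt (α ^ (b + j)) (pow_pow_of_order hα _) (msgElem n w) = 0) : w = 0 := by
  set p : F[X] := ∑ i : Fin k, C (w i) * X ^ (i : ℕ) with hp
  have hp0 : p = 0 := by
    refine eq_zero_of_degree_lt_of_eval_index_eq_zero (s := Finset.range k)
      (v := fun j => α ^ (b + j)) ?_ ?_ ?_
    · intro i hi j hj hij
      simp only [Finset.coe_range, Set.mem_Iio] at hi hj
      have := pow_injOn_Iio_orderOf (x := α) (show b + i < orderOf α by omega)
        (show b + j < orderOf α by omega) hij
      omega
    · rw [Finset.card_range]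
      exact degree_sum_fin_lt w
    · intro j hj
      have := h j (Finset.mem_range.1 hj)
      rw [evalAt_msgElem] at this
      rw [hp, eval_finsetSum]
      simpa using this
  funext i
  have := congrArg (fun q : F[X] => q.coeff i) hp0
  simp only [hp, finsetSum_coeff, coeff_C_mul_X_pow, coeff_zero] at this
  simpa [Fin.val_inj] using this

/-- Locates block `ν` in the frequency domain: only those `j` survive that the shift by `kν` carries
into the last `k` residues modulo `n`. -/
theorem evalAt_rsAut_pow {n : ℕ} [NeZero n] {α : F} (hα : orderOf α = n) {k : ℕ} (ν j : ℕ)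
    (w : Fin k → F) :
    evalAt (α ^ j) (pow_pow_of_order hα _)
        ((rsAut hα k ^ ν) (msgElem n w * rsIdem n α k)) =
      evalAt (α ^ (j + k * ν)) (pow_pow_of_order hα _) (msgElem n w) *
        if n - k ≤ (j + k * ν) % n then 1 else 0 := by
  have hy : (α ^ k) ^ ν * α ^ j = α ^ (j + k * ν) := by ring
  rw [rsAut, evalAt_scaleAut_pow _ _ _ _ _ _ (by rw [hy]; exact pow_pow_of_order hα _)]
  simp only [hy]
  rw [map_mul, evalAt_rsIdem hα]

/-- A nonzero combination of words from the consecutive blocks `G_s, …, G_{e-1}` has weight at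
least `n + 1 - k (e - s)`. -/
theorem le_hammingNorm_sum_blocks [DecidableEq F] {n : ℕ} [NeZero n] {α : F} (hα : orderOf α = n)
    {k m : ℕ} (hkm : k * (m + 1) ≤ n) {s e : ℕ} (he : e ≤ m + 1) (w : ℕ → Fin k → F)
    (hw : ∃ ν ∈ Finset.Ico s e, w ν ≠ 0) :
    n + 1 ≤ hammingNorm (∑ ν ∈ Finset.Ico s e,
      Matrix.vecMul (w ν) (coeffMatrix (rsAut hα k) (rsIdem n α k) k ν)) + k * (e - s) := by
  obtain ⟨μ, hμ, hwμ⟩ := hw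
  rw [Finset.mem_Ico] at hμ
  have hke : k * e ≤ n := (Nat.mul_le_mul_left k he).trans hkm
  have hks : k * s ≤ k * e := Nat.mul_le_mul_left k (by omega)
  have hk : k ≤ n := (Nat.le_mul_of_pos_right k (by omega)).trans hkm
  set a : CycAlg F n :=
    ∑ ν ∈ Finset.Ico s e, (rsAut hα k ^ ν) (msgElem n (w ν) * rsIdem n α k) with ha
  have hsum : (∑ ν ∈ Finset.Ico s e,
      Matrix.vecMul (w ν) (coeffMatrix (rsAut hα k) (rsIdem n α k) k ν)) = coords a := by
    change _ = coordsLin n a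
    rw [ha, map_sum]
    exact Finset.sum_congr rfl fun ν _ => vecMul_coeffMatrix _ _ _ _
  have heval : ∀ j, evalAt (α ^ j) (pow_pow_of_order hα _) a = ∑ ν ∈ Finset.Ico s e,
      evalAt (α ^ (j + k * ν)) (pow_pow_of_order hα _) (msgElem n (w ν)) *
        if n - k ≤ (j + k * ν) % n then 1 else 0 := by
    intro j
    rw [ha, map_sum]
    exact Finset.sum_congr rfl fun ν _ => evalAt_rsAut_pow hα ν j _
  have hne : coords a ≠ 0 := by
    intro h0
    have ha0 : a = 0 := by
      rw [← sum_coords a, h0]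
      simp
    -- On the frequencies of block `μ` every other block vanishes, so `a = 0` would force the
    -- message polynomial of `w μ` to vanish at `k` points.
    refine hwμ (eq_zero_of_evalAt_msgElem hα (n - k) (by omega) fun i hi => ?_)
    have hμe : k * (μ + 1) ≤ k * e := Nat.mul_le_mul_left k (by omega)
    rw [mul_add, mul_one] at hμe
    have h := heval (n - k - k * μ + i)
    rw [ha0, map_zero, Finset.sum_eq_single μ] at h
    · have hidx : n - k - k * μ + i + k * μ = n - k + i := by omega
      simp only [hidx] at h
      rw [Nat.mod_eq_of_lt (by omega), if_pos (by omega), mul_one] at h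
      exact h.symm
    · intro ν hν hνμ
      rw [Finset.mem_Ico] at hν
      rw [if_neg, mul_zero]
      rcases lt_or_gt_of_ne hνμ with hlt | hgt
      · have h1 : k * (ν + 1) ≤ k * μ := Nat.mul_le_mul_left k hlt
        rw [mul_add, mul_one] at h1
        rw [Nat.mod_eq_of_lt (by omega)]
        omega
      · have h1 : k * (μ + 1) ≤ k * ν := Nat.mul_le_mul_left k hgt
        have h2 : k * (ν + 1) ≤ k * e := Nat.mul_le_mul_left k (by omega)
        rw [mul_add, mul_one] at h1 h2
        rw [Nat.mod_eq_sub_mod (by omega), Nat.mod_eq_of_lt (by omega)]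
        omega
    · intro hμ'
      exact absurd (Finset.mem_Ico.2 hμ) hμ'
  -- The blocks `s, …, e - 1` fill the exponents `[n - ke, n - ks)`; the zeros are the cyclic
  -- complement, starting at `n - ks`.
  have hbch := lt_hammingNorm_of_consecutive_zeros hα hne (n - k * s) (n - k * (e - s)) (by
    intro j hj
    rw [sum_coords_mul_pow _ _ (pow_pow_of_order hα _), heval]
    refine Finset.sum_eq_zero fun ν hν => ?_
    rw [Finset.mem_Ico] at hν
    have h1 : k * s ≤ k * ν := Nat.mul_le_mul_left k hν.1
    have h2 : k * (ν + 1) ≤ k * e := Nat.mul_le_mul_left k hν.2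
    rw [mul_add, mul_one] at h2
    rw [Nat.mul_sub] at hj
    rw [if_neg, mul_zero]
    rw [Nat.mod_eq_sub_mod (by omega), Nat.mod_eq_of_lt (by omega)]
    omega)
  rw [hsum]
  -- The BCH lemma uses classical decidability, the goal the given `DecidableEq F`.
  have : hammingNorm (coords a) = @hammingNorm _ _ _ (fun _ _ _ => Classical.propDecidable _) _
      (coords a) := by congr!
  omega

/-! ### Counting the active blocks of a code word -/

/-- Double counting of pairs `(t, ν)` with `ν ≤ m` and `t - ν ∈ [a, b]`: the summand counts the `ν`
for a given `t`, while each `ν` admits `b - a + 1` values of `t`. -/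
theorem sum_card_windows {a b : ℕ} (hab : a ≤ b) (m : ℕ) :
    ∑ t ∈ Finset.Icc a (b + m), (min (t - a) m + 1 - (t - b)) = (b - a + 1) * (m + 1) := by
  have h1 : ∀ t ∈ Finset.Icc a (b + m), min (t - a) m + 1 - (t - b) =
      ((Finset.range (m + 1)).filter fun ν => a + ν ≤ t ∧ t ≤ b + ν).card := by
    intro t ht
    rw [Finset.mem_Icc] at ht
    rw [← Nat.card_Ico]
    congr 1
    ext ν
    simp only [Finset.mem_Ico, Finset.mem_filter, Finset.mem_range]
    omega
  have h2 : ∀ ν ∈ Finset.range (m + 1),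
      ((Finset.Icc a (b + m)).filter fun t => a + ν ≤ t ∧ t ≤ b + ν).card = b - a + 1 := by
    intro ν hν
    rw [Finset.mem_range] at hν
    have : b - a + 1 = (Finset.Icc (a + ν) (b + ν)).card := by
      rw [Nat.card_Icc]
      omega
    rw [this]
    congr 1
    ext t
    simp only [Finset.mem_Icc, Finset.mem_filter]
    omega
  rw [Finset.sum_congr rfl h1]
  refine (Finset.sum_card_bipartiteAbove_eq_sum_card_bipartiteBelow
    (fun t ν => a + ν ≤ t ∧ t ≤ b + ν)).trans ?_
  unfold Finset.bipartiteBelow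
  rw [Finset.sum_congr rfl h2, Finset.sum_const, Finset.card_range, smul_eq_mul, mul_comm]

open Classical in
/-- If the message coefficients vanish on `[0, a)` and on `(b, b + m]`, and every window of `m + 1`
coefficients ending in `[a, b + m]` is nonzero, then the code word has large weight. -/
theorem le_polyWeight_of_windows {n : ℕ} [NeZero n] {α : F} (hα : orderOf α = n)
    {k m : ℕ} (hkm : k * (m + 1) ≤ n) (u : Fin k → F[X]) {a b : ℕ} (hab : a ≤ b)
    (hlo : ∀ i < a, coeffVec u i = 0) (hhi : ∀ i, b < i → i ≤ b + m → coeffVec u i = 0)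
    (hwin : ∀ t, a ≤ t → t ≤ b + m → ∃ ν ≤ m, ν ≤ t ∧ coeffVec u (t - ν) ≠ 0) :
    (b - a + 1 + m) * (n + 1) ≤
      polyWeight (Matrix.vecMul u (rsMatrix hα k m)) + k * ((b - a + 1) * (m + 1)) := by
  have hloc : ∀ t ∈ Finset.Icc a (b + m),
      n + 1 ≤ hammingNorm (coeffVec (Matrix.vecMul u (rsMatrix hα k m)) t) +
        k * (min (t - a) m + 1 - (t - b)) := by
    intro t ht
    rw [Finset.mem_Icc] at ht
    obtain ⟨μ, hμm, hμt, hμ⟩ := hwin t ht.1 ht.2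
    have hsub : Finset.Ico (t - b) (min (t - a) m + 1) ⊆ Finset.range (m + 1) := by
      intro ν hν
      rw [Finset.mem_Ico] at hν
      rw [Finset.mem_range]
      omega
    have hword : coeffVec (Matrix.vecMul u (rsMatrix hα k m)) t =
        ∑ ν ∈ Finset.Ico (t - b) (min (t - a) m + 1), Matrix.vecMul (coeffVec u (t - ν))
          (coeffMatrix (rsAut hα k) (rsIdem n α k) k ν) := by
      rw [rsMatrix, coeffVec_vecMul_genMatrix, ← Finset.sum_subset hsub]
      · refine Finset.sum_congr rfl fun ν hν => ?_
        rw [Finset.mem_Ico] at hν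
        rw [if_pos (by omega)]
      · intro ν hν hν'
        rw [Finset.mem_range] at hν
        rw [Finset.mem_Ico] at hν'
        split_ifs with hνt
        · have : coeffVec u (t - ν) = 0 := by
            by_cases h : t - ν < a
            · exact hlo _ h
            · exact hhi _ (by omega) (by omega)
          rw [this, Matrix.zero_vecMul]
        · rfl
    rw [hword]
    refine le_hammingNorm_sum_blocks hα hkm (by omega) (fun ν => coeffVec u (t - ν)) ⟨μ, ?_, hμ⟩
    rw [Finset.mem_Ico]
    constructor
    · by_contra h
      exact hμ (hhi _ (by omega) (by omega))
    · by_contra h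
      exact hμ (hlo _ (by omega))
  have hsum := Finset.sum_le_sum hloc
  rw [Finset.sum_const, Nat.card_Icc, smul_eq_mul, Finset.sum_add_distrib, ← Finset.mul_sum,
    sum_card_windows hab] at hsum
  have hpw := sum_hammingNorm_le_polyWeight (Matrix.vecMul u (rsMatrix hα k m))
    (Finset.Icc a (b + m))
  have hcard : b + m + 1 - a = b - a + 1 + m := by omega
  rw [hcard] at hsum
  omega

end Code

/-! ### Free distance and extended row distances -/

section Distance

variable {F : Type*} [Field F]

theorem exists_coeffVec_ne_zero {ι : Type*} {u : ι → F[X]} (hu : u ≠ 0) :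
    ∃ i, coeffVec u i ≠ 0 := by
  by_contra! h
  apply hu
  funext l
  ext i
  exact congrFun (h i) l

theorem coeffVec_eq_zero_of_sup_lt {ι : Type*} [Fintype ι] (u : ι → F[X]) {i : ℕ}
    (hi : Finset.univ.sup (fun l => (u l).natDegree) < i) : coeffVec u i = 0 := by
  funext l
  exact coeff_eq_zero_of_natDegree_lt
    ((Finset.le_sup (f := fun l => (u l).natDegree) (Finset.mem_univ l)).trans_lt hi)

theorem coeffVec_eq_zero_of_vecDegree_lt {ι : Type*} [Fintype ι] (u : ι → F[X]) {i : ℕ}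
    (hi : vecDegree u < i) : coeffVec u i = 0 := by
  funext l
  exact coeff_eq_zero_of_degree_lt
    ((Finset.le_sup (f := fun l => (u l).degree) (Finset.mem_univ l)).trans_lt hi)

theorem coeffVec_vecDegree_ne_zero {ι : Type*} [Fintype ι] (u : ι → F[X]) {N : ℕ}
    (hN : vecDegree u = N) : coeffVec u N ≠ 0 := by
  intro h0
  have hne : (Finset.univ : Finset ι).Nonempty := by
    rw [Finset.nonempty_iff_ne_empty]
    intro he
    rw [vecDegree, he, Finset.sup_empty] at hN
    exact WithBot.bot_ne_coe hN
  obtain ⟨l, -, hl⟩ := Finset.exists_mem_eq_sup _ hne fun l => (u l).degree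
  have hdeg : (u l).degree = N := hl.symm.trans hN
  exact coeff_ne_zero_of_eq_degree hdeg (congrFun h0 l)

/-- Every nonzero word of the Reed-Solomon convolutional code has weight at least
`(m + 1) (n - k + 1)`. -/
theorem le_polyWeight_of_ne_zero {n : ℕ} [NeZero n] {α : F} (hα : orderOf α = n)
    {k m : ℕ} (hkm : k * (m + 1) ≤ n) {u : Fin k → F[X]} (hu : u ≠ 0) :
    (m + 1) * (n + 1) ≤ polyWeight (Matrix.vecMul u (rsMatrix hα k m)) + k * (m + 1) := by
  classical
  have hex := exists_coeffVec_ne_zero hu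
  have hzero : ∀ i, Finset.univ.sup (fun l => (u l).natDegree) < i → coeffVec u i = 0 :=
    fun i => coeffVec_eq_zero_of_sup_lt u
  set D := Finset.univ.sup fun l => (u l).natDegree
  set U := coeffVec u
  have hmax : ∀ t i, i ≤ t → U i ≠ 0 → ∃ i', i ≤ i' ∧ i' ≤ t ∧ U i' ≠ 0 ∧
      ∀ l, i' < l → l ≤ t → U l = 0 := by
    intro t i hit hi
    refine ⟨Nat.findGreatest (fun l => U l ≠ 0) t, Nat.le_findGreatest hit hi,
      Nat.findGreatest_le t, Nat.findGreatest_spec (P := fun l => U l ≠ 0) hit hi, ?_⟩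
    intro l hl hlt
    exact not_not.1 (Nat.findGreatest_is_greatest hl hlt)
  -- The least such `b` ends the first stretch of `u` without a gap of `m` zeros; what follows
  -- position `b + m` is ignored.
  have hend : ∃ b, U b ≠ 0 ∧ ∀ i, b < i → i ≤ b + m → U i = 0 := by
    obtain ⟨i, hi⟩ := hex
    obtain ⟨b, -, -, hb, hb'⟩ := hmax (max i D) i (le_max_left _ _) hi
    refine ⟨b, hb, fun l hl _ => ?_⟩
    by_cases hlD : l ≤ max i D
    · exact hb' l hl hlD
    · exact hzero l (by omega)
  obtain ⟨hb, hhi⟩ := Nat.find_spec hend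
  have hmin : ∀ i, i < Nat.find hend → ¬(U i ≠ 0 ∧ ∀ l, i < l → l ≤ i + m → U l = 0) :=
    fun i hi => Nat.find_min hend hi
  set b := Nat.find hend
  have ha := Nat.find_spec hex
  have hlo : ∀ i, i < Nat.find hex → U i = 0 := fun i hi => not_not.1 (Nat.find_min hex hi)
  have hab : Nat.find hex ≤ b := Nat.find_min' hex hb
  set a := Nat.find hex
  have hwin : ∀ t, a ≤ t → t ≤ b + m → ∃ ν ≤ m, ν ≤ t ∧ U (t - ν) ≠ 0 := by
    intro t hat htb
    obtain ⟨i, -, hit, hi, hi'⟩ := hmax t a hat ha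
    refine ⟨t - i, ?_, Nat.sub_le _ _, by rwa [Nat.sub_sub_self hit]⟩
    by_contra! hlt
    -- If the last nonzero index `i ≤ t` lay more than `m` back, a gap of `m` zeros would start
    -- after `i < b`, against the minimality of `b`.
    exact hmin i (by omega) ⟨hi, fun l hl hl' => hi' l hl (by omega)⟩
  have h := le_polyWeight_of_windows hα hkm u hab hlo hhi hwin
  -- Each step of length beyond `a = b` adds `n + 1 - k (m + 1)` to the bound, which is nonnegative.
  have h1 : k * (m + 1) * (b - a) ≤ n * (b - a) := Nat.mul_le_mul_right _ hkm
  nlinarith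

theorem le_polyWeight_of_isAtomicMessage {n : ℕ} [NeZero n] {α : F} (hα : orderOf α = n)
    {k m : ℕ} (hkm : k * (m + 1) ≤ n) {u : Fin k → F[X]} {N : ℕ}
    (hu : IsAtomicMessage m (N + m + 1) u) :
    (N + 1 + m) * (n + 1) ≤
      polyWeight (Matrix.vecMul u (rsMatrix hα k m)) + k * ((N + 1) * (m + 1)) := by
  obtain ⟨h0, hdeg, hgap⟩ := hu
  have hN : vecDegree u = N := by
    cases hd : vecDegree u with
    | bot =>
      rw [hd] at hdeg
      simp only [WithBot.bot_add] at hdeg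
      exact absurd hdeg (WithBot.bot_ne_coe)
    | coe d =>
      rw [hd] at hdeg
      have : d + m + 1 = N + m + 1 := WithBot.coe_injective hdeg
      have : d = N := by omega
      rw [this]
      rfl
  have hNne := coeffVec_vecDegree_ne_zero u hN
  refine le_polyWeight_of_windows hα hkm u (a := 0) (b := N) (Nat.zero_le _)
    (fun i hi => absurd hi (Nat.not_lt_zero i)) (fun i hi _ => ?_) fun t _ ht => ?_
  · exact coeffVec_eq_zero_of_vecDegree_lt u (by rw [hN]; exact_mod_cast hi)
  · by_cases htm : t ≤ m
    -- The window reaches back to `u_0` here, to the leading coefficient in the next case, and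
    -- otherwise contains `m` consecutive coefficients inside the message.
    · exact ⟨t, htm, le_rfl, by rwa [Nat.sub_self]⟩
    · by_cases htN : N ≤ t
      · exact ⟨t - N, by omega, Nat.sub_le _ _, by rwa [Nat.sub_sub_self htN]⟩
      · obtain ⟨l, hl, hne⟩ := hgap (t - m) (by
          rw [hN]
          have : t - m + m ≤ N + 1 := by omega
          exact_mod_cast this)
        refine ⟨m - l, Nat.sub_le _ _, by omega, ?_⟩
        have : t - (m - l) = t - m + l := by omega
        rwa [this]

/-- Needed because `sInf ∅ = 0` in `ℕ`: the row distance bound requires an admissible message of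
each degree. All coefficients are taken nonzero. -/
theorem exists_isAtomicMessage {k m : ℕ} (hk : 1 ≤ k) (hm : 1 ≤ m) (N : ℕ) :
    ∃ u : Fin k → F[X], IsAtomicMessage m (N + m + 1) u := by
  set p : F[X] := ∑ i ∈ Finset.range (N + 1), X ^ i with hp
  have hcoeff : ∀ i, p.coeff i = if i ≤ N then 1 else 0 := by
    intro i
    rw [hp, finsetSum_coeff]
    simp [coeff_X_pow]
  have hdeg : p.degree = N := by
    refine degree_eq_of_le_of_coeff_ne_zero ?_ (by simp [hcoeff])
    rw [degree_le_iff_coeff_zero]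
    intro i hi
    have : N < i := by exact_mod_cast hi
    rw [hcoeff, if_neg (by omega)]
  have hne : (Finset.univ : Finset (Fin k)).Nonempty := ⟨⟨0, hk⟩, Finset.mem_univ _⟩
  have hvec : vecDegree (fun _ : Fin k => p) = N := by
    rw [vecDegree, Finset.sup_const hne, hdeg]
  have hnz : ∀ i ≤ N, coeffVec (fun _ : Fin k => p) i ≠ 0 := by
    intro i hi h
    have := congrFun h ⟨0, hk⟩
    simp [coeffVec, hcoeff, hi] at this
  refine ⟨fun _ => p, hnz 0 (Nat.zero_le _), ?_, fun i hi => ⟨0, hm, hnz _ ?_⟩⟩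
  · rw [hvec]
    push_cast
    rfl
  · rw [hvec] at hi
    have : i + m ≤ N + 1 := by exact_mod_cast hi
    omega

/-- The Reed-Solomon convolutional code contains a word of weight at most `(m + 1) (n - k + 1)`. -/
theorem exists_polyWeight_le {n : ℕ} [NeZero n] {α : F} (hα : orderOf α = n)
    {k m : ℕ} (hk : 1 ≤ k) (hkn : k ≤ n) :
    ∃ u : Fin k → F[X], u ≠ 0 ∧
      polyWeight (Matrix.vecMul u (rsMatrix hα k m)) ≤ (m + 1) * (n - k + 1) := by
  classical
  set G₀ := coeffMatrix (rsAut hα k) (rsIdem n α k) k 0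
  set f : (Fin k → F) →ₗ[F] (Fin (k - 1) → F) :=
    LinearMap.funLeft F F (Fin.castLE (show k - 1 ≤ n by omega)) ∘ₗ G₀.vecMulLinear with hf
  -- There are `k` unknowns and only `k - 1` linear conditions.
  have hker : LinearMap.ker f ≠ ⊥ := LinearMap.ker_ne_bot_of_finrank_lt (by simp; omega)
  obtain ⟨w, hw, hw0⟩ := (Submodule.ne_bot_iff _).1 hker
  have hu0 : coeffVec (fun i => C (w i)) 0 = w := by
    funext l
    simp [coeffVec]
  have hu1 : ∀ t, t ≠ 0 → coeffVec (fun i => C (w i)) t = 0 := by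
    intro t ht
    funext l
    simp [coeffVec, coeff_C, ht]
  have hword : ∀ t, coeffVec (Matrix.vecMul (fun i => C (w i)) (rsMatrix hα k m)) t =
      if t ≤ m then coords ((rsAut hα k ^ t) (msgElem n w * rsIdem n α k)) else 0 := by
    intro t
    rw [rsMatrix, coeffVec_vecMul_genMatrix, ← vecMul_coeffMatrix]
    have : ∀ ν ∈ Finset.range (m + 1),
        (if ν ≤ t then Matrix.vecMul (coeffVec (fun i => C (w i)) (t - ν))
          (coeffMatrix (rsAut hα k) (rsIdem n α k) k ν) else 0) =
        if t = ν then Matrix.vecMul w (coeffMatrix (rsAut hα k) (rsIdem n α k) k t) else 0 := by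
      intro ν _
      by_cases h : t = ν
      · subst h
        simp [hu0]
      · rw [if_neg h]
        split_ifs with h'
        · rw [hu1 _ (by omega), Matrix.zero_vecMul]
        · rfl
    rw [Finset.sum_congr rfl this, Finset.sum_ite_eq]
    simp
  have hz : ∀ i : Fin n, (i : ℕ) < k - 1 → coords (msgElem n w * rsIdem n α k) i = 0 := by
    intro i hi
    have h1 : Matrix.vecMul w G₀ i = 0 := congrFun (LinearMap.mem_ker.1 hw) ⟨i, hi⟩
    rw [vecMul_coeffMatrix] at h1
    simpa using h1
  have hwt : ∀ t, hammingNorm (coords ((rsAut hα k ^ t) (msgElem n w * rsIdem n α k))) ≤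
      n - k + 1 := by
    intro t
    have hsub : (Finset.univ.filter fun i =>
        coords ((rsAut hα k ^ t) (msgElem n w * rsIdem n α k)) i ≠ 0) ⊆
        (Finset.univ.filter fun i : Fin n => (i : ℕ) < k - 1)ᶜ := by
      intro i hi
      simp only [Finset.mem_filter, Finset.mem_univ, true_and, Finset.mem_compl] at hi ⊢
      intro hlt
      apply hi
      rw [rsAut, coords_scaleAut_pow, hz i hlt, zero_mul]
    refine (Finset.card_le_card hsub).trans ?_
    rw [Finset.card_compl, Fintype.card_fin, Fin.card_filter_val_lt]
    omega
  refine ⟨fun i => C (w i), fun h => hw0 ?_, ?_⟩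
  · rw [← hu0, h]
    rfl
  · refine (polyWeight_le_sum_hammingNorm _ (Finset.range (m + 1)) fun t ht => ?_).trans ?_
    · rw [hword, if_neg]
      rwa [Finset.mem_range, Nat.lt_succ_iff] at ht
    · refine (Finset.sum_le_card_nsmul _ _ (n - k + 1) fun t ht => ?_).trans (by simp)
      rw [hword, if_pos (Nat.lt_succ_iff.1 (Finset.mem_range.1 ht))]
      convert hwt t

end Distance

end RSConv

theorem theorem4p3 {F : Type*} [Field F] [Fintype F] {n : ℕ} [NeZero n]
    (hn : n = Fintype.card F - 1) {k : ℕ} (hk1 : 1 ≤ k) (hk2 : 2 * k ≤ n)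
    {α : F} (hα : orderOf α = n) {m : ℕ} (hm1 : 1 ≤ m) (hm2 : m ≤ n / k - 1) :
    (RSConv.freeDist (RSConv.code (RSConv.rsMatrix hα k m)) : ℤ) =
        ((m : ℤ) + 1) * ((n : ℤ) - k + 1) ∧
      ∀ j : ℕ, m + 1 ≤ j →
        ((m : ℤ) + 1) * ((n : ℤ) - k + 1) +
            ((j : ℤ) - 1 - m) * ((n : ℤ) - (k : ℤ) * ((m : ℤ) + 1) + 1) ≤
          (RSConv.extRowDist (RSConv.rsMatrix hα k m) m j : ℤ) := by
  have hkm : k * (m + 1) ≤ n := by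
    -- Since `1 ≤ m`, the subtraction in `m ≤ n / k - 1` is not truncated.
    have h1 : m + 1 ≤ n / k := by omega
    exact (Nat.mul_le_mul_left k h1).trans (Nat.mul_div_le n k)
  have hkn : k ≤ n := by omega
  refine ⟨?_, fun j hj => ?_⟩
  · have hdist : RSConv.freeDist (RSConv.code (RSConv.rsMatrix hα k m)) =
        (m + 1) * (n - k + 1) := by
      have hsub : (m + 1) * (n - k + 1) + k * (m + 1) = (m + 1) * (n + 1) := by
        obtain ⟨r, rfl⟩ := Nat.exists_eq_add_of_le hkn
        rw [Nat.add_sub_cancel_left]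
        ring
      obtain ⟨u, hu, hle⟩ := RSConv.exists_polyWeight_le hα (m := m) hk1 hkn
      have hge := RSConv.le_polyWeight_of_ne_zero hα hkm hu
      refine IsLeast.csInf_eq ⟨⟨_, ⟨u, rfl⟩, ?_, ?_⟩, ?_⟩
      -- The word of `u` is nonzero because its weight is bounded below by a positive number.
      · intro h0
        rw [Matrix.vecMulLinear_apply] at h0
        have hpos : 0 < (m + 1) * (n - k + 1) := by positivity
        have hw0 : RSConv.polyWeight (0 : Fin n → F[X]) = 0 := by
          simp [RSConv.polyWeight, RSConv.coeffVec, hammingNorm]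
        rw [h0, hw0] at hge
        omega
      · rw [Matrix.vecMulLinear_apply]
        omega
      · rintro _ ⟨_, ⟨u', rfl⟩, hne, rfl⟩
        have hu' : u' ≠ 0 := by
          rintro rfl
          exact hne (map_zero _)
        have := RSConv.le_polyWeight_of_ne_zero hα hkm hu'
        rw [Matrix.vecMulLinear_apply]
        omega
    rw [hdist]
    push_cast [Nat.cast_sub hkn]
    ring
  · obtain ⟨N, rfl⟩ : ∃ N, j = N + m + 1 := ⟨j - m - 1, by omega⟩
    obtain ⟨u₀, hu₀⟩ := RSConv.exists_isAtomicMessage (F := F) hk1 hm1 N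
    obtain ⟨u, hu, hw⟩ := Nat.sInf_mem (s := {w | ∃ u : Fin k → F[X],
      RSConv.IsAtomicMessage m (N + m + 1) u ∧
        RSConv.polyWeight (Matrix.vecMul u (RSConv.rsMatrix hα k m)) = w}) ⟨_, u₀, hu₀, rfl⟩
    have h := RSConv.le_polyWeight_of_isAtomicMessage hα hkm hu
    rw [RSConv.extRowDist, ← hw]
    have hz : ((N : ℤ) + 1 + m) * (n + 1) ≤
        RSConv.polyWeight (Matrix.vecMul u (RSConv.rsMatrix hα k m)) +
          k * ((N + 1) * (m + 1)) := by exact_mod_cast h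
    push_cast
    linarith
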